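/- Let $m(\eta)=\int x\,d\eta(x)$ denote the mean of a probability distribution $\eta$ on $\mathbb{R}$ and $\mathrm{KL}(\eta,\kappa)=\int\log\frac{d\eta}{d\kappa}\,d\eta$ the Kullback-Leibler divergence. A collection $\mathcal{U}$ of probability distributions on $\mathbb{R}$ with finite means is called KL right dense if for every $\eta\in\mathcal{U}$, every $a>0$ and every $b>m(\eta)$ there is $\kappa\in\mathcal{U}$ with $\mathrm{KL}(\eta,\kappa)\le a$ and $m(\kappa)\ge b$. Let $K\ge 2$. A (possibly randomized) best-arm algorithm sequentially chooses which of $K$ arms to pull, on the basis of its past observations and its own randomization; pulls of arm $k$ yield independent samples of the $k$-th arm distribution. At each step the algorithm may stop, and when it does it announces an arm. Let $\tau\in\{0,1,\dots\}\cup\{\infty\}$ be its termination time (the total number of pulls) and $N_k(\tau)$ the number of pulls of arm $k$ before termination. The algorithm is $\delta$-correct on $\mathcal{U}$ if, for every instance $\nu=(\nu_1,\dots,\nu_K)\in\mathcal{U}^K$ with a unique arm of largest mean, the probability under $\nu$ that it stops and announces a different arm is at most $\delta$. **Theorem.** Let $\mathcal{U}$ be KL right dense, let $0<\delta<1/2$,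 consider an algorithm that is $\delta$-correct on $\mathcal{U}$, and let $\mu\in\mathcal{U}^K$ be an instance with a unique arm $i$ of largest mean. If the algorithm terminates almost surely under $\mu$, then $$\mathbb{E}_\mu[N_k(\tau)]=\infty\qquad\text{for every arm } k\ne i.$$ In any case (whether or not it terminates almost surely) $\mathbb{E}_\mu[\tau]=\infty$. Moreover, the collection of all light-tailed distributions (those whose moment generating function is finite in a neighbourhood of zero) whose support is not bounded above is KL right dense, and so is the collection of all light-tailed distributions with unbounded support. -/

import Mathlib

open MeasureTheory ProbabilityTheory InformationTheory Set
open scoped ENNReal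

universe u

namespace BestArm

noncomputable section

/-- The mean `m(η) = ∫ x dη(x)` (used below only for laws with a finite mean). -/
def mean (η : ProbabilityMeasure ℝ) : ℝ := ∫ x, x ∂(η : Measure ℝ)

/-- `U` is a KL right dense collection of probability distributions: all its members have a finite
mean, and for every `η ∈ U`, `a > 0` and `b > m(η)` some `κ ∈ U` satisfies `KL(η, κ) ≤ a` and
`m(κ) ≥ b`. -/
def IsKLRightDense (U : Set (ProbabilityMeasure ℝ)) : Prop :=
  (∀ η ∈ U, Integrable (fun x : ℝ => x) (η : Measure ℝ)) ∧
    ∀ η ∈ U, ∀ a : ℝ, 0 < a → ∀ b : ℝ, mean η < b →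
      ∃ κ ∈ U, klDiv (η : Measure ℝ) (κ : Measure ℝ) ≤ ENNReal.ofReal a ∧ b ≤ mean κ

/-- A distribution is light-tailed if its moment generating function is finite in a neighbourhood
of zero. -/
def IsLightTailed (η : ProbabilityMeasure ℝ) : Prop :=
  ∃ ε : ℝ, 0 < ε ∧ ∀ t : ℝ, |t| < ε → Integrable (fun x : ℝ => Real.exp (t * x)) (η : Measure ℝ)

/-- Arm `i` is the unique arm with the largest mean in the instance `ν`. -/
def IsBestArm {K : ℕ} (ν : Fin K → ProbabilityMeasure ℝ) (i : Fin K) : Prop :=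
  ∀ j, j ≠ i → mean (ν j) < mean (ν i)

/-- What has been observed after `n` pulls: the sequence of pulled arms and observed rewards. -/
abbrev History (K n : ℕ) : Type := Fin n → Fin K × ℝ

/-- A (possibly randomized) sequential algorithm for `K` arms. `Θ` is the space of its internal
randomization, drawn once from `seedLaw`. Having made `n` pulls, it decides from the seed and the
history whether to stop; if it stops it announces the arm `recommend n`, otherwise it pulls the arm
`sample n`. None of these rules sees the arm distributions. -/
structure Algorithm (K : ℕ) (Θ : Type u) [MeasurableSpace Θ] where
  seedLaw : ProbabilityMeasure Θ
  sample : ∀ n : ℕ, Θ × History K n → Fin K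
  measurable_sample : ∀ n, Measurable (sample n)
  stopSet : ∀ n : ℕ, Set (Θ × History K n)
  measurableSet_stopSet : ∀ n, MeasurableSet (stopSet n)
  recommend : ∀ n : ℕ, Θ × History K n → Fin K
  measurable_recommend : ∀ n, Measurable (recommend n)

/-- A sample point: the internal seed of the algorithm, together with the rewards `y n k` that arm
`k` yields if it is pulled at time `n`. -/
abbrev Outcome (K : ℕ) (Θ : Type u) : Type u := Θ × (ℕ → Fin K → ℝ)

namespace Algorithm

variable {K : ℕ} {Θ : Type u} [MeasurableSpace Θ]

/-- The law `ℙ_ν`: the rewards `y n k` are independent of each other and of the seed, and `y n k`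
has law `ν k`. -/
def law (alg : Algorithm K Θ) (ν : Fin K → ProbabilityMeasure ℝ) : Measure (Outcome K Θ) :=
  (alg.seedLaw : Measure Θ).prod
    (Measure.infinitePi fun _ : ℕ => Measure.pi fun k : Fin K => (ν k : Measure ℝ))

/-- The history of the first `n` pulls. The sampling rule is run for ever; only the pulls before
the termination time `τ` count. -/
def history (alg : Algorithm K Θ) (ω : Outcome K Θ) : ∀ n : ℕ, History K n
  | 0 => fun i => i.elim0
  | n + 1 =>
    Fin.snoc (α := fun _ => Fin K × ℝ) (alg.history ω n)
      (alg.sample n (ω.1, alg.history ω n), ω.2 n (alg.sample n (ω.1, alg.history ω n)))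

/-- The arm pulled at time `n` (the pull number `n + 1`). -/
def arm (alg : Algorithm K Θ) (ω : Outcome K Θ) (n : ℕ) : Fin K :=
  alg.sample n (ω.1, alg.history ω n)

/-- The termination time `τ`, which is also the total number of pulls; `⊤` if the algorithm never
stops. -/
def τ (alg : Algorithm K Θ) (ω : Outcome K Θ) : ℕ∞ :=
  ⨅ n ∈ {n : ℕ | (ω.1, alg.history ω n) ∈ alg.stopSet n}, (n : ℕ∞)

/-- `N_k(t)`, the number of times that arm `k` is pulled in the first `t` trials. -/
def pulls (alg : Algorithm K Θ) (ω : Outcome K Θ) (k : Fin K) (t : ℕ∞) : ℕ∞ :=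
  {s : ℕ | (s : ℕ∞) < t ∧ alg.arm ω s = k}.encard

/-- The event that the algorithm terminates and announces an arm other than `i`. -/
def wrongEvent (alg : Algorithm K Θ) (i : Fin K) : Set (Outcome K Θ) :=
  {ω | ∃ n : ℕ, alg.τ ω = n ∧ alg.recommend n (ω.1, alg.history ω n) ≠ i}

/-- The algorithm is `δ`-correct on `U`: on every instance with arms in `U` and a unique best arm,
the probability of announcing an incorrect arm is at most `δ`. -/
def IsDeltaCorrect (alg : Algorithm K Θ) (δ : ℝ) (U : Set (ProbabilityMeasure ℝ)) : Prop :=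
  ∀ ν : Fin K → ProbabilityMeasure ℝ, (∀ k, ν k ∈ U) → ∀ i : Fin K, IsBestArm ν i →
    alg.law ν (alg.wrongEvent i) ≤ ENNReal.ofReal δ

/-- `𝔼_ν[τ]`, the expected total number of pulls. -/
def expectedTotal (alg : Algorithm K Θ) (ν : Fin K → ProbabilityMeasure ℝ) : ℝ≥0∞ :=
  ∫⁻ ω, (alg.τ ω : ℝ≥0∞) ∂(alg.law ν)

/-- `𝔼_ν[N_k(τ)]`, the expected number of pulls of arm `k`. -/
def expectedPulls (alg : Algorithm K Θ) (ν : Fin K → ProbabilityMeasure ℝ) (k : Fin K) : ℝ≥0∞ :=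
  ∫⁻ ω, (alg.pulls ω k (alg.τ ω) : ℝ≥0∞) ∂(alg.law ν)

end Algorithm

end

end BestArm

/-! Suppose that a suboptimal arm `k` has a finite expected number of pulls `C` under `μ`. Right
density replaces its law by some `κ` whose mean exceeds the best one, at an arbitrarily small KL
cost. A small divergence yields a coupling of the two laws that disagrees with probability at most
`ε` (`exists_coupling_of_klDiv_le`). Run the algorithm on coupled rewards: the two runs can differ
only after a pull of arm `k` that shows a disagreement. The decision to pull is independent of the
fresh reward, so this has probability at most `C * ε` (`law_announceEvent_le`). But `i` is announced
with probability at least `1 - δ` under `μ` and at most `δ` under the modified instance, whence `1 -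
2δ ≤ C * ε`, which is false for small `ε`.

For light tails, the mixture `e^{-a} η + (1 - e^{-a}) δ_x` is within KL divergence `a` of `η`
whatever `x` is, so `x` can be chosen to give any prescribed mean. -/

namespace InformationTheory

/-! ### Bounds involving the Kullback-Leibler divergence -/

lemma one_sub_min_le_klFun {x ε : ℝ} (hx : 0 ≤ x) (hε : 0 < ε) :
    1 - min x 1 ≤ ε / 2 + klFun x / ε := by
  rcases le_total 1 x with h1 | h1
  · have := klFun_nonneg hx
    rw [min_eq_right h1]
    have : 0 ≤ ε / 2 + klFun x / ε := by positivity
    linarith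
  rw [min_eq_left h1]
  -- Apply `u ≤ sinh u` to `u = -log x ≥ 0` and multiply by `x`: `-x log x ≤ (1 - x ^ 2) / 2`.
  have key : (1 - x) ^ 2 / 2 ≤ klFun x := by
    rcases hx.eq_or_lt with rfl | hx0
    · norm_num [klFun_zero]
    have hs := Real.self_le_sinh_iff.2 (neg_nonneg.2 (Real.log_nonpos hx h1))
    rw [Real.sinh_eq, neg_neg, Real.exp_neg, Real.exp_log hx0] at hs
    have h2 := mul_le_mul_of_nonneg_left hs hx
    have h3 : x * ((x⁻¹ - x) / 2) = (1 - x ^ 2) / 2 := by field_simp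
    rw [klFun_apply]
    nlinarith
  have h4 : (1 - x) ^ 2 / 2 / ε ≤ klFun x / ε := by gcongr
  -- AM-GM for `ε` and `(1 - x) ^ 2 / ε`. It makes the bound linear in `klFun`, so that it can be
  -- integrated.
  have h5 : 1 - x ≤ ε / 2 + (1 - x) ^ 2 / 2 / ε := by
    rw [← sub_nonneg]
    have : ε / 2 + (1 - x) ^ 2 / 2 / ε - (1 - x) = (ε - (1 - x)) ^ 2 / (2 * ε) := by
      field_simp
      ring
    rw [this]
    positivity
  linarith

variable {α : Type*} [MeasurableSpace α] {p q : Measure α}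

/-- A small Kullback-Leibler divergence forces a large common part, a weak form of Pinsker's
inequality. -/
lemma exists_common_part_of_klDiv_le [IsProbabilityMeasure p] [IsProbabilityMeasure q] {ε : ℝ}
    (hε : 0 < ε) (h : klDiv p q ≤ ENNReal.ofReal (ε ^ 2 / 2)) :
    ∃ m : Measure α, m ≤ p ∧ m ≤ q ∧ 1 ≤ m univ + ENNReal.ofReal ε := by
  have hac : p ≪ q := by
    by_contra hac
    simp [klDiv_of_not_ac hac] at h
  rw [klDiv_eq_lintegral_klFun_of_ac hac] at h
  set f := p.rnDeriv q with hf
  have hfm : Measurable f := Measure.measurable_rnDeriv p q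
  -- The minimum of `p` and `q`. The mass it lacks is at most `ε / 2 + (ε ^ 2 / 2) / ε = ε`.
  refine ⟨q.withDensity fun x => min (f x) 1, ?_, ?_, ?_⟩
  · calc q.withDensity (fun x => min (f x) 1) ≤ q.withDensity f :=
          withDensity_mono (ae_of_all _ fun x => min_le_left _ _)
      _ = p := Measure.withDensity_rnDeriv_eq p q hac
  · calc q.withDensity (fun x => min (f x) 1) ≤ q.withDensity 1 :=
          withDensity_mono (ae_of_all _ fun x => min_le_right _ _)
      _ = q := withDensity_one
  · rw [withDensity_apply _ MeasurableSet.univ, Measure.restrict_univ]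
    have hpt : ∀ᵐ x ∂q, (1 : ℝ≥0∞) ≤ min (f x) 1 +
        (ENNReal.ofReal (ε / 2) + ENNReal.ofReal (klFun (f x).toReal) * ENNReal.ofReal ε⁻¹) := by
      filter_upwards [Measure.rnDeriv_lt_top p q] with x hx
      have hk := klFun_nonneg (x := (f x).toReal) ENNReal.toReal_nonneg
      rw [← ENNReal.ofReal_mul hk, ← ENNReal.ofReal_add (by positivity) (by positivity)]
      have hmin : min (f x) 1 = ENNReal.ofReal (min (f x).toReal 1) := by
        rw [ENNReal.ofReal_min, ENNReal.ofReal_toReal hx.ne, ENNReal.ofReal_one]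
      rw [hmin, ← ENNReal.ofReal_add (le_min ENNReal.toReal_nonneg zero_le_one) (by positivity)]
      rw [← ENNReal.ofReal_one]
      apply ENNReal.ofReal_le_ofReal
      have := one_sub_min_le_klFun (x := (f x).toReal) ENNReal.toReal_nonneg hε
      rw [div_eq_mul_inv (klFun _)] at this
      linarith
    have hkm : Measurable fun x => ENNReal.ofReal (klFun (f x).toReal) :=
      (measurable_klFun.comp hfm.ennreal_toReal).ennreal_ofReal
    calc (1 : ℝ≥0∞) = ∫⁻ _, 1 ∂q := by simp
      _ ≤ _ := lintegral_mono_ae hpt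
      _ = ∫⁻ x, min (f x) 1 ∂q + (ENNReal.ofReal (ε / 2) +
            (∫⁻ x, ENNReal.ofReal (klFun (f x).toReal) ∂q) * ENNReal.ofReal ε⁻¹) := by
          rw [lintegral_add_left (hfm.min measurable_const), lintegral_add_left measurable_const,
            lintegral_mul_const _ hkm]
          simp
      _ ≤ ∫⁻ x, min (f x) 1 ∂q + (ENNReal.ofReal (ε / 2) +
            ENNReal.ofReal (ε ^ 2 / 2) * ENNReal.ofReal ε⁻¹) := by gcongr
      _ = _ := by
          rw [← ENNReal.ofReal_mul (by positivity), ← ENNReal.ofReal_add (by positivity)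
            (by positivity)]
          congr 2
          field_simp
          ring

/-- The domination bounds the density `dp/dq` by `1 / r`, hence its logarithm by `-log r`. -/
lemma klDiv_le_neg_log_of_smul_le [IsProbabilityMeasure p] [IsProbabilityMeasure q] {r : ℝ}
    (hr : 0 < r) (h : ENNReal.ofReal r • p ≤ q) : klDiv p q ≤ ENNReal.ofReal (-Real.log r) := by
  have hr0 : ENNReal.ofReal r ≠ 0 := by simpa using hr
  have hle : ∀ s, p s ≤ ENNReal.ofReal r⁻¹ * q s := fun s => by
    have := h s
    rw [Measure.smul_apply, smul_eq_mul] at this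
    rw [ENNReal.ofReal_inv_of_pos hr]
    rwa [← ENNReal.mul_le_iff_le_inv hr0 ENNReal.ofReal_ne_top]
  have hac : p ≪ q := fun s hs => by simpa [hs] using hle s
  have hf : ∀ᵐ x ∂q, p.rnDeriv q x ≤ ENNReal.ofReal r⁻¹ := by
    refine ae_le_of_forall_setLIntegral_le_of_sigmaFinite (Measure.measurable_rnDeriv p q)
      fun s _ _ => ?_
    calc ∫⁻ x in s, p.rnDeriv q x ∂q ≤ p s := Measure.setLIntegral_rnDeriv_le s
      _ ≤ ENNReal.ofReal r⁻¹ * q s := hle s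
      _ = _ := by simp
  have hint : Integrable (fun x => (p.rnDeriv q x).toReal) q := Measure.integrable_toReal_rnDeriv
  have hpt : ∀ᵐ x ∂q, klFun (p.rnDeriv q x).toReal ≤
      -Real.log r * (p.rnDeriv q x).toReal + 1 - (p.rnDeriv q x).toReal := by
    filter_upwards [hf] with x hx
    set y := (p.rnDeriv q x).toReal with hy
    have hy0 : 0 ≤ y := ENNReal.toReal_nonneg
    have hyr : y ≤ r⁻¹ := ENNReal.toReal_le_of_le_ofReal (by positivity) hx
    rw [klFun_apply]
    rcases hy0.eq_or_lt with h0 | h0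
    · simp [← h0]
    have := Real.log_le_log h0 hyr
    rw [Real.log_inv] at this
    nlinarith
  have hint1 : Integrable (fun x => -Real.log r * (p.rnDeriv q x).toReal + 1) q :=
    (hint.const_mul _).add (integrable_const 1)
  rw [klDiv_eq_lintegral_klFun_of_ac hac]
  calc ∫⁻ x, ENNReal.ofReal (klFun (p.rnDeriv q x).toReal) ∂q
      ≤ ∫⁻ x, ENNReal.ofReal
          (-Real.log r * (p.rnDeriv q x).toReal + 1 - (p.rnDeriv q x).toReal) ∂q :=
        lintegral_mono_ae (hpt.mono fun x hx => ENNReal.ofReal_le_ofReal hx)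
    _ = ENNReal.ofReal (∫ x,
          (-Real.log r * (p.rnDeriv q x).toReal + 1 - (p.rnDeriv q x).toReal) ∂q) := by
        refine (ofReal_integral_eq_lintegral_ofReal (hint1.sub hint) ?_).symm
        exact hpt.mono fun x hx => (klFun_nonneg ENNReal.toReal_nonneg).trans hx
    _ = ENNReal.ofReal (-Real.log r) := by
        rw [integral_sub hint1 hint, integral_add (hint.const_mul _) (integrable_const 1),
          integral_const_mul, Measure.integral_toReal_rnDeriv hac]
        simp

end InformationTheory

/-! ### Coupling from a common part -/

namespace MeasureTheory.Measure

variable {α : Type*} [MeasurableSpace α] {p q : Measure α}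

/-- Two probability measures with a common part of mass at least `1 - t` have a coupling that
charges the complement of the diagonal with at most `t`. -/
lemma exists_coupling_of_common_part [IsProbabilityMeasure p] [IsProbabilityMeasure q]
    (hD : MeasurableSet {x : α × α | x.1 ≠ x.2}) {m : Measure α} (hp : m ≤ p)
    (hq : m ≤ q) {t : ℝ≥0∞} (ht : 1 ≤ m univ + t) :
    ∃ γ : Measure (α × α), γ.map Prod.fst = p ∧ γ.map Prod.snd = q ∧
      γ {x | x.1 ≠ x.2} ≤ t := by
  have hm : IsFiniteMeasure m := isFiniteMeasure_of_le p hp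
  set s : ℝ≥0∞ := 1 - m univ with hs
  have hsp : (p - m) univ = s := by rw [sub_apply MeasurableSet.univ hp, measure_univ]
  have hsq : (q - m) univ = s := by rw [sub_apply MeasurableSet.univ hq, measure_univ]
  have hst : s ≤ t := tsub_le_iff_left.2 ht
  have hs_top : s ≠ ⊤ := by simp [hs]
  -- If `s = 0` then `s⁻¹ = ⊤`, which is harmless because `ρ` vanishes.
  have hcancel : ∀ ρ : Measure α, ρ univ = s → s⁻¹ • (s • ρ) = ρ := fun ρ hρ => by
    by_cases h0 : s = 0
    · rw [h0, measure_univ_eq_zero] at hρ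
      simp [hρ]
    · rw [smul_smul, ENNReal.inv_mul_cancel h0 hs_top, one_smul]
  have hdiag : Measurable fun x : α => (x, x) := measurable_id.prodMk measurable_id
  -- The common part sits on the diagonal; the two residuals, each of mass `s`, are coupled
  -- independently.
  refine ⟨m.map (fun x => (x, x)) + s⁻¹ • (p - m).prod (q - m), ?_, ?_, ?_⟩
  · rw [Measure.map_add _ _ measurable_fst, Measure.map_smul, map_map measurable_fst hdiag,
      map_fst_prod, hsq, hcancel _ hsp, add_comm]
    simpa [Function.comp_def] using sub_add_cancel_of_le hp
  · rw [Measure.map_add _ _ measurable_snd, Measure.map_smul, map_map measurable_snd hdiag,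
      map_snd_prod, hsp, hcancel _ hsq, add_comm]
    simpa [Function.comp_def] using sub_add_cancel_of_le hq
  · calc (m.map (fun x => (x, x)) + s⁻¹ • (p - m).prod (q - m)) {x | x.1 ≠ x.2}
        ≤ 0 + s⁻¹ * (s * s) := by
          rw [Measure.add_apply, Measure.smul_apply, smul_eq_mul, map_apply hdiag hD]
          gcongr
          · simp
          · refine (measure_mono (subset_univ _)).trans_eq ?_
            rw [← univ_prod_univ, prod_prod, hsp, hsq]
      _ ≤ s := by
          rw [zero_add, ← mul_assoc]
          exact mul_le_of_le_one_left (zero_le) (ENNReal.inv_mul_le_one s)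
      _ ≤ t := hst

end MeasureTheory.Measure

/-! ### Right density of light-tailed laws -/

namespace BestArm

lemma IsLightTailed.integrable_id {η : ProbabilityMeasure ℝ} (h : IsLightTailed η) :
    Integrable (fun x : ℝ => x) (η : Measure ℝ) := by
  obtain ⟨ε, hε, h⟩ := h
  have h1 := h (ε / 2) (by rw [abs_of_pos] <;> linarith)
  have h2 := h (-(ε / 2)) (by rw [abs_neg, abs_of_pos] <;> linarith)
  simpa using integrable_pow_of_integrable_exp_mul (by positivity) h1 h2 1

/-- Any class of light-tailed laws that is cut out by an upward closed condition on the support is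
KL right dense: move a small amount of mass to a far away point. -/
lemma isKLRightDense_lightTailed {P : Set ℝ → Prop} (hP : ∀ s t, s ⊆ t → P s → P t) :
    IsKLRightDense {η | IsLightTailed η ∧ P (η : Measure ℝ).support} := by
  refine ⟨fun η hη => hη.1.integrable_id, fun η hη a ha b _ => ?_⟩
  -- The weight makes `-log r = a`; the atom `x` is chosen so that `r * mean η + (1 - r) * x = b`.
  set r := Real.exp (-a) with hr
  have hr0 : 0 < r := Real.exp_pos _
  have hr1 : r < 1 := by simpa [hr] using ha
  set x := (b - r * mean η) / (1 - r) with hx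
  set κ : Measure ℝ := ENNReal.ofReal r • (η : Measure ℝ) +
    ENNReal.ofReal (1 - r) • Measure.dirac x with hκ
  have hκ1 : IsProbabilityMeasure κ := ⟨by
    simp only [hκ, Measure.add_apply, Measure.smul_apply, measure_univ, smul_eq_mul, mul_one]
    rw [← ENNReal.ofReal_add hr0.le (by linarith)]
    simp⟩
  have hle : ENNReal.ofReal r • (η : Measure ℝ) ≤ κ := Measure.le_add_right le_rfl
  have hint : ∀ f : ℝ → ℝ, Integrable f (η : Measure ℝ) → Integrable f κ :=
    fun f h => (h.smul_measure ENNReal.ofReal_ne_top).add_measure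
      ((integrable_dirac (by simp)).smul_measure ENNReal.ofReal_ne_top)
  refine ⟨⟨κ, hκ1⟩, ⟨?_, ?_⟩, ?_, ?_⟩
  · obtain ⟨ε, hε, h⟩ := hη.1
    exact ⟨ε, hε, fun t ht => hint _ (h t ht)⟩
  · refine hP _ _ ?_ hη.2
    refine Measure.AbsolutelyContinuous.support_mono fun s hs => ?_
    have := hle s
    simp only [ProbabilityMeasure.coe_mk] at hs
    rw [hs, Measure.smul_apply, smul_eq_mul, nonpos_iff_eq_zero, mul_eq_zero] at this
    exact this.resolve_left (by simpa using hr0)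
  · have := klDiv_le_neg_log_of_smul_le hr0 hle
    simpa [hr] using this
  · have hη1 := hη.1.integrable_id
    have : mean ⟨κ, hκ1⟩ = r * mean η + (1 - r) * x := by
      simp only [mean, ProbabilityMeasure.coe_mk, hκ]
      rw [integral_add_measure (hη1.smul_measure ENNReal.ofReal_ne_top)
        ((integrable_dirac (by simp)).smul_measure ENNReal.ofReal_ne_top),
        integral_smul_measure, integral_smul_measure, integral_dirac,
        ENNReal.toReal_ofReal hr0.le, ENNReal.toReal_ofReal (by linarith)]
      simp
    rw [this, hx, mul_div_cancel₀ _ (by linarith)]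
    linarith

end BestArm

/-! ### Independence of the past and the next reward -/

namespace MeasureTheory.Measure

/-- In an i.i.d. sequence with an independent seed, the term number `n` is independent of the seed
and the previous terms. -/
lemma prod_infinitePi_inter_eval {Θ α : Type*} [MeasurableSpace Θ] [MeasurableSpace α]
    (σ : Measure Θ) [SFinite σ] (ρ : Measure α) [IsProbabilityMeasure ρ] {n : ℕ}
    {A : Set (Θ × (ℕ → α))} (hA : MeasurableSet A)
    (hdep : ∀ θ y y', (∀ m < n, y m = y' m) → (θ, y) ∈ A → (θ, y') ∈ A)
    {D : Set α} (hD : MeasurableSet D) :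
    σ.prod (infinitePi fun _ : ℕ => ρ) (A ∩ {ω | ω.2 n ∈ D}) =
      σ.prod (infinitePi fun _ : ℕ => ρ) A * ρ D := by
  classical
  obtain ⟨a⟩ := nonempty_of_isProbabilityMeasure ρ
  have hDn : MeasurableSet {ω : Θ × (ℕ → α) | ω.2 n ∈ D} :=
    ((measurable_pi_apply n).comp measurable_snd) hD
  rw [prod_apply (hA.inter hDn), prod_apply hA, ← lintegral_mul_const _
    (measurable_measure_prodMk_left hA)]
  refine lintegral_congr fun θ => ?_
  -- Padding with a constant presents each section of `A` as the preimage of a measurable set of the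
  -- first `n` coordinates.
  let ext : ((Finset.range n) → α) → ℕ → α := fun z m =>
    if h : m ∈ Finset.range n then z ⟨m, h⟩ else a
  have hext : Measurable ext := by
    refine measurable_pi_lambda _ fun m => ?_
    by_cases h : m ∈ Finset.range n
    · simpa only [ext, h, dif_pos] using measurable_pi_apply _
    · simpa only [ext, h, dif_neg, not_false_eq_true] using measurable_const
  have hB : MeasurableSet (ext ⁻¹' (Prod.mk θ ⁻¹' A)) := hext (measurable_prodMk_left hA)
  have hindep := (ProbabilityTheory.iIndepFun_infinitePi (P := fun _ : ℕ => ρ)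
    (X := fun _ x => x) (fun _ => measurable_id)).indepFun_finset (Finset.range n) {n}
    (by simp) (fun i => measurable_pi_apply i)
  have hC : MeasurableSet {z : ({n} : Finset ℕ) → α | z ⟨n, by simp⟩ ∈ D} :=
    measurable_pi_apply _ hD
  have h := hindep.measure_inter_preimage_eq_mul _ _ hB hC
  have h1 : (fun (y : ℕ → α) (i : Finset.range n) => y i) ⁻¹' (ext ⁻¹' (Prod.mk θ ⁻¹' A)) =
      Prod.mk θ ⁻¹' A := by
    ext y
    have : ∀ m < n, ext (fun i : Finset.range n => y i) m = y m := fun m hm => by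
      simp [ext, hm]
    exact ⟨hdep _ _ _ this, hdep _ _ _ fun m hm => (this m hm).symm⟩
  have h2 : (fun (y : ℕ → α) (i : ({n} : Finset ℕ)) => y i) ⁻¹'
      {z | z ⟨n, by simp⟩ ∈ D} = (fun y => y n) ⁻¹' D := rfl
  rw [h1, h2] at h
  rw [preimage_inter]
  refine h.trans ?_
  congr 1
  rw [← map_apply (measurable_pi_apply n) hD, infinitePi_map_eval]

end MeasureTheory.Measure

/-! ### Histories, termination and announcement -/

namespace BestArm.Algorithm

variable {K : ℕ} {Θ : Type u} [MeasurableSpace Θ] (alg : Algorithm K Θ)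

/-- Only the rewards of the arms actually pulled enter the history; the other coordinates may
differ. -/
lemma history_congr {ω ω' : Outcome K Θ} (h1 : ω.1 = ω'.1) {n : ℕ}
    (h2 : ∀ m < n, ω.2 m (alg.arm ω m) = ω'.2 m (alg.arm ω m)) :
    alg.history ω n = alg.history ω' n := by
  induction n with
  | zero => funext i; exact i.elim0
  | succ n ih =>
    have ih := ih fun m hm => h2 m (by omega)
    have h := h2 n (by omega)
    simp only [arm] at h
    simp only [history, ← ih, ← h1, h]

lemma measurable_history (n : ℕ) :
    Measurable fun ω : Outcome K Θ => (ω.1, alg.history ω n) := by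
  induction n with
  | zero => exact measurable_fst.prodMk (measurable_pi_lambda _ fun i => i.elim0)
  | succ n ih =>
    refine measurable_fst.prodMk (measurable_pi_lambda _ fun i => ?_)
    have harm : Measurable fun ω : Outcome K Θ => alg.sample n (ω.1, alg.history ω n) :=
      (alg.measurable_sample n).comp ih
    have hev : Measurable fun x : (Fin K → ℝ) × Fin K => x.1 x.2 :=
      measurable_from_prod_countable_left fun k => measurable_pi_apply k
    refine Fin.lastCases ?_ (fun i => ?_) i
    · simp only [history, Fin.snoc_last]
      exact harm.prodMk
        (hev.comp (((measurable_pi_apply n).comp measurable_snd).prodMk harm))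
    · simp only [history, Fin.snoc_castSucc]
      exact (measurable_pi_apply i).comp (measurable_snd.comp ih)

lemma measurable_arm (n : ℕ) : Measurable fun ω => alg.arm ω n :=
  (alg.measurable_sample n).comp (alg.measurable_history n)

/-- Stopping at index `n` precedes the pull at time `n`, hence `m ≤ n` rather than `m < n`. -/
lemma lt_τ_iff {ω : Outcome K Θ} {n : ℕ} :
    (n : ℕ∞) < alg.τ ω ↔ ∀ m ≤ n, (ω.1, alg.history ω m) ∉ alg.stopSet m := by
  rw [← not_iff_not, not_lt, τ]
  push Not
  constructor
  · intro h
    by_contra! hc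
    have : ((n + 1 : ℕ) : ℕ∞) ≤
        ⨅ n ∈ {n : ℕ | (ω.1, alg.history ω n) ∈ alg.stopSet n}, (n : ℕ∞) := by
      refine le_iInf₂ fun m hm => ?_
      have : ¬ m ≤ n := fun hmn => hc m hmn hm
      exact_mod_cast (by omega : n + 1 ≤ m)
    have := this.trans h
    norm_cast at this
    omega
  · rintro ⟨m, hmn, hm⟩
    exact (iInf₂_le m hm).trans (by exact_mod_cast hmn)

lemma τ_eq_iff {ω : Outcome K Θ} {n : ℕ} :
    alg.τ ω = n ↔ (ω.1, alg.history ω n) ∈ alg.stopSet n ∧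
      ∀ m < n, (ω.1, alg.history ω m) ∉ alg.stopSet m := by
  constructor
  · intro h
    have h1 : ∀ m < n, (ω.1, alg.history ω m) ∉ alg.stopSet m := fun m hm =>
      alg.lt_τ_iff.1 (by rw [h]; exact_mod_cast hm) m le_rfl
    refine ⟨?_, h1⟩
    by_contra hc
    have : (n : ℕ∞) < alg.τ ω := alg.lt_τ_iff.2 fun m hm => by
      rcases hm.eq_or_lt with rfl | hm
      · exact hc
      · exact h1 m hm
    exact this.ne h.symm
  · rintro ⟨h1, h2⟩
    refine le_antisymm (iInf₂_le n h1) (le_iInf₂ fun m hm => ?_)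
    by_contra! hc
    exact h2 m (by exact_mod_cast hc) hm

lemma measurableSet_lt_τ (n : ℕ) : MeasurableSet {ω | (n : ℕ∞) < alg.τ ω} := by
  simp only [lt_τ_iff, ofPred_forall]
  exact .iInter fun m => .iInter fun _ =>
    (alg.measurable_history m (alg.measurableSet_stopSet m)).compl

/-- The event that the arm `k` is pulled at time `n`, before termination. -/
def pullEvent (k : Fin K) (n : ℕ) : Set (Outcome K Θ) :=
  {ω | (n : ℕ∞) < alg.τ ω ∧ alg.arm ω n = k}

/-- The event that the algorithm terminates and announces the arm `i`. -/
def announceEvent (i : Fin K) : Set (Outcome K Θ) :=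
  {ω | ∃ n : ℕ, alg.τ ω = n ∧ alg.recommend n (ω.1, alg.history ω n) = i}

lemma measurableSet_pullEvent (k : Fin K) (n : ℕ) : MeasurableSet (alg.pullEvent k n) :=
  (alg.measurableSet_lt_τ n).inter (alg.measurable_arm n (measurableSet_singleton k))

lemma measurableSet_announceEvent (i : Fin K) : MeasurableSet (alg.announceEvent i) := by
  simp only [announceEvent, τ_eq_iff, ofPred_exists]
  refine .iUnion fun n => .inter (.inter ?_ ?_) ?_
  · exact alg.measurable_history n (alg.measurableSet_stopSet n)
  · have : MeasurableSet {ω : Outcome K Θ | ∀ m < n, (ω.1, alg.history ω m) ∉ alg.stopSet m} := by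
      simp only [ofPred_forall]
      exact .iInter fun m => .iInter fun _ =>
        (alg.measurable_history m (alg.measurableSet_stopSet m)).compl
    exact this
  · exact (alg.measurable_recommend n).comp (alg.measurable_history n) (measurableSet_singleton i)

/-- Predictability: whether arm `k` is pulled at time `n` is settled by the seed and the rewards
before `n`, so it is independent of the reward at `n`. -/
lemma pullEvent_congr {ω ω' : Outcome K Θ} (h1 : ω.1 = ω'.1) {n : ℕ}
    (h2 : ∀ m < n, ω.2 m = ω'.2 m) {k : Fin K} (h : ω ∈ alg.pullEvent k n) :
    ω' ∈ alg.pullEvent k n := by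
  have hh : ∀ m ≤ n, alg.history ω m = alg.history ω' m := fun m hm =>
    alg.history_congr h1 fun j hj => by rw [h2 j (by omega)]
  refine ⟨alg.lt_τ_iff.2 fun m hm => ?_, ?_⟩
  · rw [← h1, ← hh m hm]
    exact alg.lt_τ_iff.1 h.1 m hm
  · rw [arm, ← h1, ← hh n le_rfl]
    exact h.2

/-- Up to termination both runs see the same history, so they stop together with the same
announcement. -/
lemma announceEvent_congr {ω ω' : Outcome K Θ} (h1 : ω.1 = ω'.1)
    (h2 : ∀ n : ℕ, (n : ℕ∞) < alg.τ ω → ω.2 n (alg.arm ω n) = ω'.2 n (alg.arm ω n)) {i : Fin K}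
    (h : ω ∈ alg.announceEvent i) : ω' ∈ alg.announceEvent i := by
  obtain ⟨n, hn, hi⟩ := h
  have hh : ∀ m ≤ n, alg.history ω m = alg.history ω' m := fun m hm =>
    alg.history_congr h1 fun j hj => h2 j (by rw [hn]; exact_mod_cast hj.trans_le hm)
  rw [τ_eq_iff] at hn
  refine ⟨n, alg.τ_eq_iff.2 ⟨?_, fun m hm => ?_⟩, ?_⟩
  · rw [← h1, ← hh n le_rfl]; exact hn.1
  · rw [← h1, ← hh m hm.le]; exact hn.2 m hm
  · rw [← h1, ← hh n le_rfl]; exact hi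

/-! ### Expected numbers of pulls and the coupling inequality -/

lemma pulls_eq_tsum (ω : Outcome K Θ) (k : Fin K) :
    ((alg.pulls ω k (alg.τ ω) : ℕ∞) : ℝ≥0∞) =
      ∑' n, (alg.pullEvent k n).indicator (fun _ => (1 : ℝ≥0∞)) ω := by
  rw [pulls, ← ENNReal.tsum_set_one, tsum_subtype _ fun _ => (1 : ℝ≥0∞)]
  rfl

lemma expectedPulls_eq_tsum (ν : Fin K → ProbabilityMeasure ℝ) (k : Fin K) :
    alg.expectedPulls ν k = ∑' n, alg.law ν (alg.pullEvent k n) := by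
  simp only [expectedPulls, pulls_eq_tsum]
  rw [lintegral_tsum fun n =>
    (measurable_const.indicator (alg.measurableSet_pullEvent k n)).aemeasurable]
  exact tsum_congr fun n => lintegral_indicator_one (alg.measurableSet_pullEvent k n)

instance (ν : Fin K → ProbabilityMeasure ℝ) : IsProbabilityMeasure (alg.law ν) := by
  unfold law; infer_instance

lemma expectedPulls_le_expectedTotal (ν : Fin K → ProbabilityMeasure ℝ) (k : Fin K) :
    alg.expectedPulls ν k ≤ alg.expectedTotal ν := by
  refine lintegral_mono fun ω => ENat.toENNReal_le.2 ?_
  refine (encard_le_encard (t := {s : ℕ | (s : ℕ∞) < alg.τ ω}) fun s hs => hs.1).trans ?_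
  cases h : alg.τ ω with
  | top => exact le_top
  | coe n =>
    have : {s : ℕ | (s : ℕ∞) < n} = (Finset.range n : Set ℕ) := by ext; simp
    rw [this, encard_coe_eq_coe_finsetCard, Finset.card_range]

lemma expectedTotal_eq_top_of_not_ae {ν : Fin K → ProbabilityMeasure ℝ}
    (h : ¬ ∀ᵐ ω ∂(alg.law ν), alg.τ ω < ⊤) : alg.expectedTotal ν = ⊤ := by
  by_contra hc
  refine h ?_
  -- Measurability comes from writing `τ` as the sum of the indicators of `n < τ`.
  have hm : Measurable fun ω => (alg.τ ω : ℝ≥0∞) := by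
    have : ∀ ω, (alg.τ ω : ℝ≥0∞) =
        ∑' n : ℕ, {ω | (n : ℕ∞) < alg.τ ω}.indicator (fun _ => (1 : ℝ≥0∞)) ω := fun ω => by
      have h1 : ∑' n : ℕ, {ω | (n : ℕ∞) < alg.τ ω}.indicator (fun _ => (1 : ℝ≥0∞)) ω =
          ({n : ℕ | (n : ℕ∞) < alg.τ ω}.encard : ℝ≥0∞) := by
        rw [← ENNReal.tsum_set_one, tsum_subtype _ fun _ => (1 : ℝ≥0∞)]
        rfl
      rw [h1]
      cases h : alg.τ ω with
      | top => simp [encard_univ]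
      | coe n =>
        have : {s : ℕ | (s : ℕ∞) < n} = (Finset.range n : Set ℕ) := by ext; simp
        rw [this, encard_coe_eq_coe_finsetCard, Finset.card_range]
    simp only [this]
    exact Measurable.tsum fun n =>
      measurable_const.indicator (alg.measurableSet_lt_τ n)
  filter_upwards [ae_lt_top hm hc] with ω hω
  simpa using hω

/-- The coupling inequality for a sequential algorithm: if the rewards under `μ` and `ν` are
coupled arm by arm, the two runs can only differ after a pull of an arm whose coupled rewards
disagree. -/
lemma law_announceEvent_le (μ ν : Fin K → ProbabilityMeasure ℝ) (γ : Fin K → Measure (ℝ × ℝ))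
    (h1 : ∀ k, (γ k).map Prod.fst = μ k) (h2 : ∀ k, (γ k).map Prod.snd = ν k) (i : Fin K) :
    alg.law μ (alg.announceEvent i) ≤ alg.law ν (alg.announceEvent i) +
      ∑ k, alg.expectedPulls μ k * γ k {x | x.1 ≠ x.2} := by
  have hγ : ∀ k, IsProbabilityMeasure (γ k) := fun k => ⟨by
    have := congrArg (fun m => m univ) (h1 k)
    simpa [Measure.map_apply measurable_fst MeasurableSet.univ] using this⟩
  -- One space `Q` carries a shared seed and coupled reward pairs; its projections `π₁` and `π₂`
  -- have laws `ℙ_μ` and `ℙ_ν`.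
  set ρ : Measure (Fin K → ℝ × ℝ) := Measure.pi γ with hρ
  set Q : Measure (Θ × (ℕ → Fin K → ℝ × ℝ)) :=
    (alg.seedLaw : Measure Θ).prod (Measure.infinitePi fun _ : ℕ => ρ) with hQ
  have hproj : ∀ (f : ℝ × ℝ → ℝ), Measurable f → ∀ (κ : Fin K → ProbabilityMeasure ℝ),
      (∀ k, (γ k).map f = κ k) →
      MeasurePreserving (fun ω : Θ × (ℕ → Fin K → ℝ × ℝ) =>
        ((ω.1, fun n k => f (ω.2 n k)) : Outcome K Θ)) Q (alg.law κ) := by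
    intro f hf κ hκ
    have hpi : MeasurePreserving (fun (y : Fin K → ℝ × ℝ) k => f (y k)) ρ
        (Measure.pi fun k => (κ k : Measure ℝ)) :=
      measurePreserving_pi _ _ fun k => ⟨hf, hκ k⟩
    refine (MeasurePreserving.id (alg.seedLaw : Measure Θ)).prod
      (g := fun (y : ℕ → Fin K → ℝ × ℝ) n k => f (y n k))
      ⟨by fun_prop, ?_⟩
    rw [Measure.infinitePi_map_pi (fun _ : ℕ => ρ) (f := fun _ (y : Fin K → ℝ × ℝ) k => f (y k))
      fun _ => hpi.measurable]
    simp only [hpi.map_eq]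
  have hp1 := hproj Prod.fst measurable_fst μ h1
  have hp2 := hproj Prod.snd measurable_snd ν h2
  set π₁ := fun ω : Θ × (ℕ → Fin K → ℝ × ℝ) => ((ω.1, fun n k => (ω.2 n k).1) : Outcome K Θ)
  set π₂ := fun ω : Θ × (ℕ → Fin K → ℝ × ℝ) => ((ω.1, fun n k => (ω.2 n k).2) : Outcome K Θ)
  have hD : MeasurableSet {x : ℝ × ℝ | x.1 ≠ x.2} :=
    (measurableSet_eq_fun measurable_fst measurable_snd).compl
  have hDk : ∀ k, MeasurableSet {y : Fin K → ℝ × ℝ | (y k).1 ≠ (y k).2} := fun k =>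
    (measurable_pi_apply k : Measurable fun y : Fin K → ℝ × ℝ => y k) hD
  have hρD : ∀ k, ρ {y | (y k).1 ≠ (y k).2} = γ k {x | x.1 ≠ x.2} := fun k => by
    rw [← (measurePreserving_eval γ k).measure_preimage hD.nullMeasurableSet]
    rfl
  have hsub : π₁ ⁻¹' alg.announceEvent i ⊆ π₂ ⁻¹' alg.announceEvent i ∪
      ⋃ k, ⋃ n, (π₁ ⁻¹' alg.pullEvent k n ∩ {ω | ω.2 n ∈ {y | (y k).1 ≠ (y k).2}}) := by
    intro ω hω
    by_contra hc
    simp only [mem_union, mem_iUnion, not_or, not_exists] at hc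
    refine hc.1 (alg.announceEvent_congr (ω := π₁ ω) (ω' := π₂ ω) rfl (fun n hn => ?_) hω)
    by_contra hne
    exact hc.2 (alg.arm (π₁ ω) n) n ⟨⟨hn, rfl⟩, hne⟩
  calc alg.law μ (alg.announceEvent i) = Q (π₁ ⁻¹' alg.announceEvent i) :=
        (hp1.measure_preimage (alg.measurableSet_announceEvent i).nullMeasurableSet).symm
    _ ≤ Q (π₂ ⁻¹' alg.announceEvent i) + ∑ k, ∑' n,
          Q (π₁ ⁻¹' alg.pullEvent k n ∩ {ω | ω.2 n ∈ {y | (y k).1 ≠ (y k).2}}) := by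
        refine (measure_mono hsub).trans ((measure_union_le _ _).trans ?_)
        gcongr
        refine (measure_iUnion_fintype_le _ _).trans ?_
        exact Finset.sum_le_sum fun k _ => measure_iUnion_le _
    _ = _ := by
        congr 1
        · exact hp2.measure_preimage (alg.measurableSet_announceEvent i).nullMeasurableSet
        · refine Finset.sum_congr rfl fun k _ => ?_
          -- As in Wald's identity, each pull event is independent of the reward pair drawn at that
          -- time, so every term factorizes.
          rw [expectedPulls_eq_tsum, ← ENNReal.tsum_mul_right]
          refine tsum_congr fun n => ?_
          rw [hQ, Measure.prod_infinitePi_inter_eval _ _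
            (hp1.measurable (alg.measurableSet_pullEvent k n)) ?_ (hDk k), ← hQ, hρD,
            hp1.measure_preimage (alg.measurableSet_pullEvent k n).nullMeasurableSet]
          intro θ y y' hyy h
          exact alg.pullEvent_congr (ω := π₁ (θ, y)) (ω' := π₁ (θ, y')) rfl
            (fun m hm => by simp only [π₁, hyy m hm]) h

end BestArm.Algorithm

/-! ### Infinite expected number of pulls -/

namespace BestArm

lemma exists_coupling_of_klDiv_le {p q : ProbabilityMeasure ℝ} {ε : ℝ} (hε : 0 < ε)
    (h : klDiv (p : Measure ℝ) (q : Measure ℝ) ≤ ENNReal.ofReal (ε ^ 2 / 2)) :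
    ∃ γ : Measure (ℝ × ℝ), γ.map Prod.fst = p ∧ γ.map Prod.snd = q ∧
      γ {x | x.1 ≠ x.2} ≤ ENNReal.ofReal ε := by
  obtain ⟨m, hp, hq, hm⟩ := exists_common_part_of_klDiv_le hε h
  exact Measure.exists_coupling_of_common_part
    (measurableSet_eq_fun measurable_fst measurable_snd).compl hp hq hm

namespace Algorithm

variable {K : ℕ} {Θ : Type u} [MeasurableSpace Θ] (alg : Algorithm K Θ)

/-- Changing the law of a single arm by little in Kullback-Leibler divergence changes the law of the
announced arm by little, in proportion to the expected number of pulls of that arm. -/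
lemma law_announceEvent_le_update (μ : Fin K → ProbabilityMeasure ℝ) (k : Fin K)
    {κ : ProbabilityMeasure ℝ} {ε : ℝ} (hε : 0 < ε)
    (h : klDiv (μ k : Measure ℝ) (κ : Measure ℝ) ≤ ENNReal.ofReal (ε ^ 2 / 2)) (i : Fin K) :
    alg.law μ (alg.announceEvent i) ≤ alg.law (Function.update μ k κ) (alg.announceEvent i) +
      alg.expectedPulls μ k * ENNReal.ofReal ε := by
  obtain ⟨γ₀, h1, h2, h3⟩ := exists_coupling_of_klDiv_le hε h
  have hdiag : Measurable fun x : ℝ => (x, x) := measurable_id.prodMk measurable_id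
  -- Unchanged arms get the diagonal coupling, which never disagrees, so only arm `k` contributes.
  set γ : Fin K → Measure (ℝ × ℝ) :=
    Function.update (fun j => (μ j : Measure ℝ).map fun x => (x, x)) k γ₀ with hγ
  have hγk : γ k = γ₀ := Function.update_self ..
  have hγj : ∀ j, j ≠ k → γ j = (μ j : Measure ℝ).map fun x => (x, x) := fun j hj =>
    Function.update_of_ne hj ..
  refine (alg.law_announceEvent_le μ (Function.update μ k κ) γ (fun j => ?_) (fun j => ?_)
    i).trans ?_
  · rcases eq_or_ne j k with rfl | hj
    · rw [hγk, h1]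
    · rw [hγj j hj, Measure.map_map measurable_fst hdiag]
      exact Measure.map_id
  · rcases eq_or_ne j k with rfl | hj
    · rw [hγk, h2, Function.update_self]
    · rw [hγj j hj, Measure.map_map measurable_snd hdiag, Function.update_of_ne hj]
      exact Measure.map_id
  · gcongr
    rw [Finset.sum_eq_single k _ (by simp), hγk]
    · gcongr
    · intro j _ hj
      have : γ j {x | x.1 ≠ x.2} = 0 := by
        have hD : MeasurableSet {x : ℝ × ℝ | x.1 ≠ x.2} :=
          (measurableSet_eq_fun measurable_fst measurable_snd).compl
        rw [hγj j hj, Measure.map_apply hdiag hD]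
        simp
      rw [this, mul_zero]

/-- Almost sure termination enters here: it leaves no outcome, up to a null set, without an
announcement. -/
lemma one_le_law_announceEvent_add {ν : Fin K → ProbabilityMeasure ℝ}
    (h : ∀ᵐ ω ∂(alg.law ν), alg.τ ω < ⊤) (i : Fin K) :
    1 ≤ alg.law ν (alg.announceEvent i) + alg.law ν (alg.wrongEvent i) := by
  rw [← measure_univ (μ := alg.law ν)]
  refine (measure_mono_ae ?_).trans (measure_union_le _ _)
  filter_upwards [h] with ω hω _
  obtain ⟨n, hn⟩ := ENat.ne_top_iff_exists.1 hω.ne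
  by_cases hi : alg.recommend n (ω.1, alg.history ω n) = i
  · exact Or.inl ⟨n, hn.symm, hi⟩
  · exact Or.inr ⟨n, hn.symm, hi⟩

lemma IsDeltaCorrect.expectedPulls_eq_top {alg : Algorithm K Θ} {δ : ℝ}
    {U : Set (ProbabilityMeasure ℝ)} (hU : IsKLRightDense U) (hδ0 : 0 < δ) (hδ : δ < 1 / 2)
    (halg : alg.IsDeltaCorrect δ U) {μ : Fin K → ProbabilityMeasure ℝ} (hμ : ∀ k, μ k ∈ U)
    {i : Fin K} (hi : IsBestArm μ i) (hτ : ∀ᵐ ω ∂(alg.law μ), alg.τ ω < ⊤) {k : Fin K}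
    (hk : k ≠ i) : alg.expectedPulls μ k = ⊤ := by
  by_contra hC
  set C := (alg.expectedPulls μ k).toReal with hCdef
  have hC0 : 0 ≤ C := ENNReal.toReal_nonneg
  have hCe : alg.expectedPulls μ k = ENNReal.ofReal C := (ENNReal.ofReal_toReal hC).symm
  -- The denominator `C + 1` is positive even if `C = 0` and makes `C * ε < 1 - 2 * δ` strict.
  set ε := (1 - 2 * δ) / (C + 1) with hεdef
  have hε : 0 < ε := div_pos (by linarith) (by linarith)
  -- The `+ 1` makes `k` the unique best arm of the new instance, where announcing `i` is an error.
  obtain ⟨κ, hκU, hκ, hmean⟩ := hU.2 (μ k) (hμ k) (ε ^ 2 / 2) (by positivity)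
    (mean (μ i) + 1) (by linarith [hi k hk])
  set ν := Function.update μ k κ with hν
  have hνU : ∀ j, ν j ∈ U := fun j => by
    rcases eq_or_ne j k with rfl | hj
    · rwa [hν, Function.update_self]
    · rw [hν, Function.update_of_ne hj]
      exact hμ j
  have hνk : IsBestArm ν k := fun j hj => by
    rw [hν, Function.update_self, Function.update_of_ne hj]
    rcases eq_or_ne j i with rfl | hji
    · linarith
    · linarith [hi j hji]
  have hwrong : alg.law ν (alg.announceEvent i) ≤ ENNReal.ofReal δ := by
    refine (measure_mono ?_).trans (halg ν hνU k hνk)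
    rintro ω ⟨n, hn, hr⟩
    exact ⟨n, hn, fun h => hk (h.symm.trans hr)⟩
  have hsum : (1 : ℝ≥0∞) ≤ ENNReal.ofReal (δ + C * ε + δ) := by
    rw [ENNReal.ofReal_add (by positivity) hδ0.le, ENNReal.ofReal_add hδ0.le (by positivity),
      ENNReal.ofReal_mul hC0, ← hCe]
    refine (alg.one_le_law_announceEvent_add hτ i).trans (add_le_add ?_ (halg μ hμ i hi))
    exact (alg.law_announceEvent_le_update μ k hε hκ i).trans (add_le_add hwrong le_rfl)
  rw [ENNReal.one_le_ofReal] at hsum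
  have hεC : ε * (C + 1) = 1 - 2 * δ := div_mul_cancel₀ _ (by linarith)
  nlinarith

end Algorithm

end BestArm

theorem theorem2 :
    (∀ (K : ℕ), 2 ≤ K → ∀ (U : Set (ProbabilityMeasure ℝ)), BestArm.IsKLRightDense U →
      ∀ (δ : ℝ), 0 < δ → δ < 1 / 2 →
      ∀ (Θ : Type u) [MeasurableSpace Θ] (alg : BestArm.Algorithm K Θ), alg.IsDeltaCorrect δ U →
      ∀ (μ : Fin K → ProbabilityMeasure ℝ), (∀ k, μ k ∈ U) →
      ∀ (i : Fin K), BestArm.IsBestArm μ i →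
        ((∀ᵐ ω ∂(alg.law μ), alg.τ ω < ⊤) → ∀ k, k ≠ i → alg.expectedPulls μ k = ⊤) ∧
        alg.expectedTotal μ = ⊤) ∧
    BestArm.IsKLRightDense
      {η | BestArm.IsLightTailed η ∧ ¬ BddAbove (η : Measure ℝ).support} ∧
    BestArm.IsKLRightDense
      {η | BestArm.IsLightTailed η ∧ ¬ Bornology.IsBounded (η : Measure ℝ).support} := by
  refine ⟨?_, BestArm.isKLRightDense_lightTailed (P := fun s => ¬ BddAbove s)
    fun s t hst h h' => h (h'.mono hst),
    BestArm.isKLRightDense_lightTailed (P := fun s => ¬ Bornology.IsBounded s)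
    fun s t hst h h' => h (h'.subset hst)⟩
  intro K hK U hU δ hδ0 hδ Θ _ alg halg μ hμ i hi
  have hpulls : (∀ᵐ ω ∂(alg.law μ), alg.τ ω < ⊤) → ∀ k, k ≠ i → alg.expectedPulls μ k = ⊤ :=
    fun hτ k hk => halg.expectedPulls_eq_top hU hδ0 hδ hμ hi hτ hk
  refine ⟨hpulls, ?_⟩
  -- With termination, `K ≥ 2` supplies a suboptimal arm, whose pulls are at most `τ`; without it,
  -- `τ` is infinite with positive probability.
  by_cases hτ : ∀ᵐ ω ∂(alg.law μ), alg.τ ω < ⊤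
  · have : Nontrivial (Fin K) := Fin.nontrivial_iff_two_le.2 hK
    obtain ⟨k, hk⟩ := exists_ne i
    exact top_unique ((hpulls hτ k hk).symm.le.trans (alg.expectedPulls_le_expectedTotal μ k))
  · exact alg.expectedTotal_eq_top_of_not_ae hτ
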